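/- Consider a uninode single-period power market with finitely many producers $i\in I$ and consumers $j\in J$. Unit $i$, initially offline, has status-output variables $x_i=(u_i,g_i)\in X_i=\{u_i\in\{0,1\},\ g_i\ge 0,\ u_ig_i^{\min}\le g_i\le u_ig_i^{\max}\}$ with $0\le g_i^{\min}\le g_i^{\max}$, and cost $C_i(x_i)=c_i(g_i)+w_iu_i$, where $w_i\ge 0$, $c_i(0)=0$ and $c_i$ is continuous, non-decreasing and convex on $\{0\}\cup[g_i^{\min},g_i^{\max}]$. Consumer $j$ chooses $d_j\in Y_j=[d_j^{\min},d_j^{\max}]$, $0\le d_j^{\min}\le d_j^{\max}$, and has a continuous concave benefit function $B_j$ on $Y_j$. Let $\Omega$ be the set of all $(x,d)$ with $x_i\in X_i$, $d_j\in Y_j$ and $\sum_i g_i=\sum_j d_j$; assume $\Omega\ne\emptyset$. Let $(x^*,d^*)$ be a maximizer of $\sum_jB_j(d_j)-\sum_iC_i(x_i)$ over $\Omega$, and let $\bar\Omega$ be the set of all $(\bar x,\bar d)\in\Omega$ that maximize this function over $\{(x,d)\in\Omega: x\le\bar x,\ d\le\bar d\}$ (componentwise), with projections $\bar\Omega_i^{prod}$,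 $\bar\Omega_j^{cons}$ on $X_i$, $Y_j$. For $\varepsilon_i,\rho_j>0$ put $$\tilde X_i(\varepsilon_i)=\{x_i\in X_i: C_i(x_i)=\min_{X_i}C_i\}\cup\{x_i\in X_i:\ |g_i-\bar g_i|\le\varepsilon_i\text{ for some }(\bar u_i,\bar g_i)\in\bar\Omega_i^{prod}\},$$ $$\tilde Y_j(\rho_j)=\{d_j\in Y_j: B_j(d_j)=B_j(d_j^{\min})\}\cup\{d_j\in Y_j:\ |d_j-\bar d_j|\le\rho_j\text{ for some }\bar d_j\in\bar\Omega_j^{cons}\}.$$ For a price $p\in\mathbb R$ let $\tilde\pi_i^{prod}(p,\varepsilon_i)=\sup_{x_i\in\tilde X_i(\varepsilon_i)}(pg_i-C_i(x_i))$, $\tilde\pi_j^{cons}(p,\rho_j)=\sup_{d_j\in\tilde Y_j(\rho_j)}(B_j(d_j)-pd_j)$ and $\pi_j^{cons}(p)=\max_{d_j\in Y_j}(B_j(d_j)-pd_j)$. The set of market prices $\tilde P^+(\varepsilon,\rho)$ is the set of minimizers over $p\in\mathbb R$ of $$\sum_{j\in J}\tilde\pi_j^{cons}(p,\rho_j)+\sum_{i\in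 I}\tilde\pi_i^{prod}(p,\varepsilon_i).$$ The uplift of a player at a price $p$ is its (modified) maximal profit at $p$ minus its profit at $(x^*,d^*)$, and the total uplift is the sum over all players. **Proposition 7.** Assume that $g_i^{\min}=0$ for all $i$ and that every consumer bid consists of a fixed load $d_j^{\min}$ and/or one price-sensitive step with a constant price $b_j\ge 0$, i.e. $B_j(d_j)=b_jd_j$ on $Y_j$ up to an additive constant. Then for all $\varepsilon_i>0$ ($i\in I$) and all $\rho_j>0$ ($j\in J$), $$\tilde P^+(\varepsilon,\rho)=\arg\min_{p\in\mathbb R}\Bigl(\sum_{j\in J}\pi_j^{cons}(p)+\sum_{i\in I}\tilde\pi_i^{prod}(p,\varepsilon_i)\Bigr),$$ i.e. replacing $\tilde\pi_j^{cons}(p,\rho_j)$ by $\pi_j^{cons}(p)$ for all $j$ does not change the set of market prices. The uplifts, however, can change: there are a market satisfying these assumptions and constants $\eta,\delta>0$ such that for all $\varepsilon_i,\rho_j\in(0,\delta)$ the set $\tilde P^+(\varepsilon,\rho)$ is nonempty, and at every $p\in\tilde P^+(\varepsilon,\rho)$ and for every optimal $(x^*,d^*)$ the replacement increases the total uplift,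 and the uplift of some consumer, by at least $\eta$. -/

import Mathlib

open Set

noncomputable section

/-- A uninode single-period power market with `n` producers (generating units, all of them
initially offline) and `m` consumers.  Unit `i` has output limits `gmin i`, `gmax i`, fixed cost
`w i` and variable cost function `c i`; consumer `j` has fixed load `dmin j`, maximal consumption
`dmax j` and benefit function `B j`. -/
structure Market (n m : ℕ) where
  gmin : Fin n → ℝ
  gmax : Fin n → ℝ
  w : Fin n → ℝ
  c : Fin n → ℝ → ℝ
  dmin : Fin m → ℝ
  dmax : Fin m → ℝ
  B : Fin m → ℝ → ℝ
  gmin_nonneg : ∀ i, 0 ≤ gmin i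
  gmin_le_gmax : ∀ i, gmin i ≤ gmax i
  w_nonneg : ∀ i, 0 ≤ w i
  c_zero : ∀ i, c i 0 = 0
  c_mono : ∀ i, MonotoneOn (c i) ({0} ∪ Icc (gmin i) (gmax i))
  c_cont : ∀ i, ContinuousOn (c i) ({0} ∪ Icc (gmin i) (gmax i))
  /-- Convexity on the (possibly non-convex) set of admissible outputs. -/
  c_convex : ∀ i, ∀ x ∈ ({0} ∪ Icc (gmin i) (gmax i) : Set ℝ),
    ∀ y ∈ ({0} ∪ Icc (gmin i) (gmax i) : Set ℝ), ∀ a b : ℝ, 0 ≤ a → 0 ≤ b → a + b = 1 →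
      a * x + b * y ∈ ({0} ∪ Icc (gmin i) (gmax i) : Set ℝ) →
        c i (a * x + b * y) ≤ a * c i x + b * c i y
  dmin_nonneg : ∀ j, 0 ≤ dmin j
  dmin_le_dmax : ∀ j, dmin j ≤ dmax j
  B_cont : ∀ j, ContinuousOn (B j) (Icc (dmin j) (dmax j))
  B_concave : ∀ j, ConcaveOn ℝ (Icc (dmin j) (dmax j)) (B j)

namespace Market

variable {n m : ℕ} (S : Market n m)

/-- The individual feasible set `X_i` of status-output pairs `x = (u, g)` of unit `i`. -/
def X (i : Fin n) : Set (ℝ × ℝ) :=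
  {x | (x.1 = 0 ∨ x.1 = 1) ∧ 0 ≤ x.2 ∧ x.1 * S.gmin i ≤ x.2 ∧ x.2 ≤ x.1 * S.gmax i}

/-- The total cost `C_i(u, g) = c_i(g) + w_i u`. -/
def cost (i : Fin n) (x : ℝ × ℝ) : ℝ := S.c i x.2 + S.w i * x.1

/-- The individual feasible set `Y_j = [dmin_j, dmax_j]` of consumer `j`. -/
def Y (j : Fin m) : Set ℝ := Icc (S.dmin j) (S.dmax j)

/-- `π_i^prod(p, x_i) = p g_i - C_i(x_i)`. -/
def prodProfitAt (i : Fin n) (p : ℝ) (x : ℝ × ℝ) : ℝ := p * x.2 - S.cost i x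

/-- `π_j^cons(p, d_j) = B_j(d_j) - p d_j`. -/
def consProfitAt (j : Fin m) (p : ℝ) (d : ℝ) : ℝ := S.B j d - p * d

/-- The original profit function `π_j^cons(p)` of consumer `j`. -/
def consProfit (j : Fin m) (p : ℝ) : ℝ := sSup (S.consProfitAt j p '' S.Y j)

/-- The feasible set `Ω` of the centralized dispatch problem: individually feasible outputs and
consumptions subject to power balance. -/
def feasible : Set ((Fin n → ℝ × ℝ) × (Fin m → ℝ)) :=
  {z | (∀ i, z.1 i ∈ S.X i) ∧ (∀ j, z.2 j ∈ S.Y j) ∧ ∑ i, (z.1 i).2 = ∑ j, z.2 j}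

/-- The total market utility, maximized in the centralized dispatch. -/
def welfare (z : (Fin n → ℝ × ℝ) × (Fin m → ℝ)) : ℝ :=
  ∑ j, S.B j (z.2 j) - ∑ i, S.cost i (z.1 i)

/-- The centralized dispatch outcomes `(x*, d*)`. -/
def optimal : Set ((Fin n → ℝ × ℝ) × (Fin m → ℝ)) :=
  {z | z ∈ S.feasible ∧ ∀ z' ∈ S.feasible, S.welfare z' ≤ S.welfare z}

/-- The set `Ω̄` of technologically and economically feasible dispatches: those feasible `z` that
solve the centralized dispatch problem with the additional constraints `z' ≤ z`
(componentwise, in statuses, outputs and consumptions). -/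
def econFeasible : Set ((Fin n → ℝ × ℝ) × (Fin m → ℝ)) :=
  {z | z ∈ S.feasible ∧ ∀ z' ∈ S.feasible, z' ≤ z → S.welfare z' ≤ S.welfare z}

/-- `Ω̄_i^prod`, the projection of `Ω̄` on `X_i`. -/
def econProd (i : Fin n) : Set (ℝ × ℝ) := {x | ∃ z ∈ S.econFeasible, z.1 i = x}

/-- `Ω̄_j^cons`, the projection of `Ω̄` on `Y_j`. -/
def econCons (j : Fin m) : Set ℝ := {d | ∃ z ∈ S.econFeasible, z.2 j = d}

/-- The sunk cost of unit `i`, the lowest cost on `X_i`. -/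
def sunkCost (i : Fin n) : ℝ := sInf (S.cost i '' S.X i)

/-- The unit being initially offline, its sunk cost is zero (the cost of staying offline). -/
theorem sunkCost_eq_zero (i : Fin n) : S.sunkCost i = 0 := by
  have h0 : (0 : ℝ) ∈ S.cost i '' S.X i :=
    ⟨(0, 0), by simp [X], by simp [cost, S.c_zero]⟩
  have hl : ∀ y ∈ S.cost i '' S.X i, 0 ≤ y := by
    rintro _ ⟨⟨u, g⟩, ⟨hu, hg, h1, h2⟩, rfl⟩
    have hw := S.w_nonneg i
    simp only [cost] at *
    rcases hu with rfl | rfl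
    · have : g = 0 := by linarith
      simp [this, S.c_zero]
    · have := S.c_mono i (Or.inl rfl : (0 : ℝ) ∈ _) (Or.inr ⟨by linarith, by linarith⟩) hg
      rw [S.c_zero] at this
      linarith
  exact IsLeast.csInf_eq ⟨h0, hl⟩

/-- `Ψ_i^prod`: the points of `X_i` with cost equal to the sunk cost. -/
def psiProd (i : Fin n) : Set (ℝ × ℝ) := {x | x ∈ S.X i ∧ S.cost i x = S.sunkCost i}

/-- `Ψ_j^cons`: the points of `Y_j` with benefit equal to the sunk benefit `B_j(dmin_j)`. -/
def psiCons (j : Fin m) : Set ℝ := {d | d ∈ S.Y j ∧ S.B j d = S.B j (S.dmin j)}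

/-- The modified individual feasible set `X̃_i(ε_i)`. -/
def modX (i : Fin n) (ε : ℝ) : Set (ℝ × ℝ) :=
  S.psiProd i ∪ ⋃ xb ∈ S.econProd i, {x | x ∈ S.X i ∧ |x.2 - xb.2| ≤ ε}

/-- The modified individual feasible set `Ỹ_j(ρ_j)`. -/
def modY (j : Fin m) (ρ : ℝ) : Set ℝ :=
  S.psiCons j ∪ ⋃ db ∈ S.econCons j, {d | d ∈ S.Y j ∧ |d - db| ≤ ρ}

/-- The modified profit function `π̃_i^prod(p, ε_i)`. -/
def modProdProfit (i : Fin n) (p ε : ℝ) : ℝ := sSup (S.prodProfitAt i p '' S.modX i ε)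

/-- The modified profit function `π̃_j^cons(p, ρ_j)`. -/
def modConsProfit (j : Fin m) (p ρ : ℝ) : ℝ := sSup (S.consProfitAt j p '' S.modY j ρ)

/-- The set of market prices `P̃⁺(ε, ρ)`: the minimizers of the modified dual problem. -/
def modPrices (ε : Fin n → ℝ) (ρ : Fin m → ℝ) : Set ℝ :=
  {p | ∀ q : ℝ, ∑ j, S.modConsProfit j p (ρ j) + ∑ i, S.modProdProfit i p (ε i) ≤
    ∑ j, S.modConsProfit j q (ρ j) + ∑ i, S.modProdProfit i q (ε i)}

/-- The minimizers of the modified dual problem in which every `π̃_j^cons(p, ρ_j)` is replaced by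
the original `π_j^cons(p)`. -/
def replacedPrices (ε : Fin n → ℝ) : Set ℝ :=
  {p | ∀ q : ℝ, ∑ j, S.consProfit j p + ∑ i, S.modProdProfit i p (ε i) ≤
    ∑ j, S.consProfit j q + ∑ i, S.modProdProfit i q (ε i)}

/-- The uplift of producer `i` at price `p`, given the dispatch `z`. -/
def prodUplift (i : Fin n) (p ε : ℝ) (z : (Fin n → ℝ × ℝ) × (Fin m → ℝ)) : ℝ :=
  S.modProdProfit i p ε - S.prodProfitAt i p (z.1 i)

/-- The uplift of consumer `j` at price `p`, given the dispatch `z`. -/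
def consUplift (j : Fin m) (p ρ : ℝ) (z : (Fin n → ℝ × ℝ) × (Fin m → ℝ)) : ℝ :=
  S.modConsProfit j p ρ - S.consProfitAt j p (z.2 j)

/-- The uplift of consumer `j` when `π_j^cons(p)` is used in place of `π̃_j^cons(p, ρ_j)`. -/
def replacedConsUplift (j : Fin m) (p : ℝ) (z : (Fin n → ℝ × ℝ) × (Fin m → ℝ)) : ℝ :=
  S.consProfit j p - S.consProfitAt j p (z.2 j)

/-- The total uplift. -/
def totalUplift (p : ℝ) (ε : Fin n → ℝ) (ρ : Fin m → ℝ)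
    (z : (Fin n → ℝ × ℝ) × (Fin m → ℝ)) : ℝ :=
  ∑ j, S.consUplift j p (ρ j) z + ∑ i, S.prodUplift i p (ε i) z

/-- The total uplift when the original consumer profit functions are used. -/
def replacedTotalUplift (p : ℝ) (ε : Fin n → ℝ)
    (z : (Fin n → ℝ × ℝ) × (Fin m → ℝ)) : ℝ :=
  ∑ j, S.replacedConsUplift j p z + ∑ i, S.prodUplift i p (ε i) z

/-- Every unit has zero minimum output. -/
def ZeroMinOutput : Prop := ∀ i, S.gmin i = 0

/-- Every consumer bid is a fixed load `dmin_j` and/or one price-sensitive step with a constant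
price `b_j ≥ 0`: up to a constant term, `B_j(d) = b_j d` on `[dmin_j, dmax_j]`. -/
def OneStepBids : Prop :=
  ∃ b β : Fin m → ℝ, ∀ j, 0 ≤ b j ∧ ∀ d ∈ S.Y j, S.B j d = β j + b j * d

end Market

end

/-!
The modified dual function `f` and the function `F` obtained from it by using the original consumer
profits are sums of suprema of affine functions of the price. At a price `r` they have subgradients
`G - s'` and `G - s`: here `G` is the total output of profit-maximizing units, and `s' ≤ s` are the
total demands in which every consumer with `b j ≥ r` takes the largest quantity available to him
(`D j = sSup (modY j)` for `f`, and `dmax j` for `F`), all others taking their fixed load. By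
`setOf_minimizers_eq`, `f` and `F` have the same minimizers as soon as `s' ≤ G ≤ s` forces `s' = s`.

That implication is `Market.demand_eq_of_supply_between`. If `s' ≤ G ≤ s` and `s' < s`, then some
consumer has `D j < dmax j`, and then every economically feasible dispatch gives him less than
`D j`. On the other hand, `G` can be distributed among the consumers so that everybody gets at
least his share of `s'`. The resulting dispatch is economically feasible by
`Market.econFeasible_of_supported`: any smaller dispatch loses at least `r` per unit of consumption,
and cannot raise the profit of a unit at price `r`. The last point has to be checked for all outputs
below the one chosen, not only for those in `modX` (`Market.prodProfitAt_le_of_le`). If some unit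
would gain from a smaller output, lower all units to their best smaller outputs. Either
the result still covers the fixed loads, and then it is part of an economically feasible dispatch;
or one stops on the way at the outputs that cover exactly the fixed loads, which is economically
feasible because nothing below it is feasible. In both cases a point of `modX` beats the
maximizer, by concavity in the second one.

For the uplifts, take two units of capacity `1`, start-up cost `1` and no variable cost, and a
consumer who values up to `3/2` at `6/5` per unit. Serving more than `1` requires both units, one of
which then produces at most `3/4` and is better switched off; so `D ≤ 1 + ρ`. The market price
is the average cost `1 < 6/5` of a fully loaded unit, and the replacement raises the uplift of the
consumer by `(6/5 - 1) * (3/2 - D)`.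
-/

open Set

/-! ### Real-variable preliminaries -/

/-- Two functions with subgradients `G - s'` and `G - s`, where `s' ≤ s`, have the same
minimizers if `G` never separates `s'` from `s`. -/
theorem setOf_minimizers_eq {f F G s' s : ℝ → ℝ}
    (hf : ∀ r q, f r + (q - r) * (G r - s' r) ≤ f q)
    (hF : ∀ r q, F r + (q - r) * (G r - s r) ≤ F q)
    (hs : ∀ r, s' r ≤ s r) (hkey : ∀ r, s' r ≤ G r → G r ≤ s r → s' r = s r) :
    {p | ∀ q, F p ≤ F q} = {p | ∀ q, f p ≤ f q} := by
  -- A price `r` strictly between `p` and `q`, at which the function still exceeds its value at `q`.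
  have near : ∀ {h D : ℝ → ℝ} (_ : ∀ r q, h r + (q - r) * D r ≤ h q) {p q : ℝ}, h q < h p →
      ∃ t : ℝ, 0 < t ∧ t < 1 ∧ h q < h (p + t * (q - p)) := by
    intro h D hh p q hpq
    set A := |(q - p) * D p| with hA
    have hA0 : 0 ≤ A := abs_nonneg _
    set e := h p - h q with he
    have he0 : 0 < e := by linarith
    refine ⟨e / (2 * (e + A)), by positivity, ?_, ?_⟩
    · rw [div_lt_one (by positivity)]; linarith
    · set t := e / (2 * (e + A)) with ht
      have ht0 : 0 < t := by positivity
      have htA : t * (e + A) = e / 2 := by rw [ht]; field_simp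
      have h1 := hh p (p + t * (q - p))
      have h2 : -A ≤ (q - p) * D p := neg_abs_le _
      have h3 : t * -A ≤ t * ((q - p) * D p) := mul_le_mul_of_nonneg_left h2 ht0.le
      have h4 : 0 < t * e := by positivity
      nlinarith
  ext p
  simp only [mem_ofPred_eq]
  constructor
  · intro hp q
    by_contra! hq
    obtain ⟨t, ht0, ht1, htq⟩ := near hf hq
    set r := p + t * (q - p) with hr
    have h1 := hf r q
    have h2 := hF r p
    have h3 := hp r
    have e1 : q - r = (1 - t) * (q - p) := by rw [hr]; ring
    have e2 : p - r = -t * (q - p) := by rw [hr]; ring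
    rw [e1] at h1
    rw [e2] at h2
    have h4 : (1 - t) * ((q - p) * (G r - s' r)) < 0 := by linarith
    have h5 : 0 ≤ t * ((q - p) * (G r - s r)) := by linarith
    have h4' : (q - p) * (G r - s' r) < 0 := by
      by_contra! h; have := mul_nonneg (by linarith : 0 ≤ 1 - t) h; linarith
    have h5' : 0 ≤ (q - p) * (G r - s r) := nonneg_of_mul_nonneg_right h5 ht0
    have := hs r
    rcases lt_or_ge q p with hqp | hqp
    · have a1 : s' r < G r := by by_contra! h; nlinarith
      have a2 : G r ≤ s r := by by_contra! h; nlinarith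
      have := hkey r a1.le a2
      rw [this] at h4'; linarith
    · nlinarith
  · intro hp q
    by_contra! hq
    obtain ⟨t, ht0, ht1, htq⟩ := near hF hq
    set r := p + t * (q - p) with hr
    have h1 := hF r q
    have h2 := hf r p
    have h3 := hp r
    have e1 : q - r = (1 - t) * (q - p) := by rw [hr]; ring
    have e2 : p - r = -t * (q - p) := by rw [hr]; ring
    rw [e1] at h1
    rw [e2] at h2
    have h4 : (1 - t) * ((q - p) * (G r - s r)) < 0 := by linarith
    have h5 : 0 ≤ t * ((q - p) * (G r - s' r)) := by linarith
    have h4' : (q - p) * (G r - s r) < 0 := by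
      by_contra! h; have := mul_nonneg (by linarith : 0 ≤ 1 - t) h; linarith
    have h5' : 0 ≤ (q - p) * (G r - s' r) := nonneg_of_mul_nonneg_right h5 ht0
    have := hs r
    rcases lt_or_ge p q with hqp | hqp
    · have a1 : G r < s r := by by_contra! h; nlinarith
      have a2 : s' r ≤ G r := by by_contra! h; nlinarith
      have := hkey r a2 a1.le
      rw [← this] at h4'; linarith
    · nlinarith

theorem exists_sum_add_mul_sub_eq {ι : Type*} [Fintype ι] {a b : ι → ℝ} {s : ℝ}
    (ha : ∑ i, a i ≤ s) (hb : s ≤ ∑ i, b i) :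
    ∃ t : ℝ, 0 ≤ t ∧ t ≤ 1 ∧ ∑ i, (a i + t * (b i - a i)) = s := by
  have hsum : ∀ t : ℝ, ∑ i, (a i + t * (b i - a i)) =
      ∑ i, a i + t * (∑ i, b i - ∑ i, a i) := fun t ↦ by
    rw [Finset.sum_add_distrib, ← Finset.mul_sum, Finset.sum_sub_distrib]
  rcases (ha.trans hb).eq_or_lt with h | h
  · exact ⟨0, le_rfl, zero_le_one, by rw [hsum]; linarith⟩
  · have h' : 0 < ∑ i, b i - ∑ i, a i := by linarith
    refine ⟨(s - ∑ i, a i) / (∑ i, b i - ∑ i, a i), div_nonneg (by linarith) h'.le,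
      (div_le_one h').2 (by linarith), ?_⟩
    rw [hsum, div_mul_cancel₀ _ h'.ne']
    ring

theorem le_sSup_image_of_mem_closure {α : Type*} [TopologicalSpace α] [T2Space α] {A K : Set α}
    {φ : α → ℝ} (hK : IsCompact K) (hA : A ⊆ K) (hφ : ContinuousOn φ K) {x : α}
    (hx : x ∈ closure A) : φ x ≤ sSup (φ '' A) := by
  have hbdd : BddAbove (φ '' A) := (hK.bddAbove_image hφ).mono (image_mono hA)
  have hcl : IsClosed (K ∩ φ ⁻¹' Iic (sSup (φ '' A))) :=
    hφ.preimage_isClosed_of_isClosed hK.isClosed isClosed_Iic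
  have hsub : A ⊆ K ∩ φ ⁻¹' Iic (sSup (φ '' A)) := fun a ha ↦
    ⟨hA ha, le_csSup hbdd (mem_image_of_mem φ ha)⟩
  exact (closure_minimal hsub hcl hx).2

theorem exists_mem_closure_sSup_image_eq {α : Type*} [TopologicalSpace α] [T2Space α]
    {A K : Set α} {φ : α → ℝ} (hK : IsCompact K) (hA : A ⊆ K) (hφ : ContinuousOn φ K)
    (hne : A.Nonempty) : ∃ x ∈ closure A, sSup (φ '' A) = φ x := by
  have hsub : closure A ⊆ K := closure_minimal hA hK.isClosed
  obtain ⟨x, hx, hmax⟩ := (hK.of_isClosed_subset isClosed_closure hsub).exists_isMaxOn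
    hne.closure (hφ.mono hsub)
  refine ⟨x, hx, le_antisymm (csSup_le (hne.image φ) ?_)
    (le_sSup_image_of_mem_closure hK hA hφ hx)⟩
  rintro _ ⟨a, ha, rfl⟩
  exact hmax (subset_closure ha)

namespace Market

variable {n m : ℕ} {S : Market n m}

/-! ### Producers -/

theorem gmax_nonneg (S : Market n m) (i : Fin n) : 0 ≤ S.gmax i :=
  (S.gmin_nonneg i).trans (S.gmin_le_gmax i)

theorem off_mem_X (S : Market n m) (i : Fin n) : ((0, 0) : ℝ × ℝ) ∈ S.X i := by simp [X]

theorem snd_le_gmax {i : Fin n} {x : ℝ × ℝ} (hx : x ∈ S.X i) : x.2 ≤ S.gmax i := by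
  obtain ⟨h | h, -, -, h2⟩ := hx <;> rw [h] at h2 <;> linarith [S.gmax_nonneg i]

theorem fst_eq_one_of_snd_pos {i : Fin n} {x : ℝ × ℝ} (hx : x ∈ S.X i) (h : 0 < x.2) :
    x.1 = 1 := by
  obtain ⟨h1 | h1, -, -, h2⟩ := hx
  · rw [h1] at h2; linarith
  · exact h1

theorem snd_mem_of_mem_X {i : Fin n} {x : ℝ × ℝ} (hx : x ∈ S.X i) :
    x.2 ∈ ({0} ∪ Icc (S.gmin i) (S.gmax i) : Set ℝ) := by
  obtain ⟨h | h, h0, h1, h2⟩ := hx <;> rw [h] at h1 h2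
  · left; simp only [mem_singleton_iff]; linarith
  · right; constructor <;> linarith

theorem cost_off (S : Market n m) (i : Fin n) : S.cost i (0, 0) = 0 := by
  simp [cost, S.c_zero]

theorem isCompact_X (S : Market n m) (i : Fin n) : IsCompact (S.X i) := by
  refine isCompact_Icc (a := ((0, 0) : ℝ × ℝ)) (b := (1, S.gmax i)) |>.of_isClosed_subset ?_ ?_
  · refine ((isClosed_eq continuous_fst continuous_const).union
      (isClosed_eq continuous_fst continuous_const)).inter ?_
    exact (isClosed_le continuous_const continuous_snd).inter
      ((isClosed_le (by fun_prop) continuous_snd).inter (isClosed_le continuous_snd (by fun_prop)))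
  · intro x hx
    have := snd_le_gmax hx
    obtain ⟨h | h, h0, -⟩ := hx <;> exact ⟨⟨by simp [h], h0⟩, ⟨by simp [h], this⟩⟩

theorem continuousOn_prodProfitAt (S : Market n m) (i : Fin n) (p : ℝ) :
    ContinuousOn (S.prodProfitAt i p) (S.X i) := by
  have hc : ContinuousOn (fun x : ℝ × ℝ ↦ S.c i x.2) (S.X i) :=
    (S.c_cont i).comp continuous_snd.continuousOn fun _ hx ↦ snd_mem_of_mem_X hx
  exact ContinuousOn.sub (by fun_prop) (hc.add (by fun_prop))

theorem modX_subset (i : Fin n) (ε : ℝ) : S.modX i ε ⊆ S.X i :=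
  union_subset (fun _ hx ↦ hx.1) (iUnion₂_subset fun _ _ _ hx ↦ hx.1)

theorem off_mem_modX (S : Market n m) (i : Fin n) (ε : ℝ) :
    ((0, 0) : ℝ × ℝ) ∈ S.modX i ε :=
  Or.inl ⟨S.off_mem_X i, by rw [cost_off, sunkCost_eq_zero]⟩

theorem econProd_subset_modX {i : Fin n} {ε : ℝ} (hε : 0 ≤ ε) : S.econProd i ⊆ S.modX i ε := by
  intro x hx
  refine Or.inr (mem_biUnion hx ⟨?_, by simpa⟩)
  obtain ⟨z, hz, rfl⟩ := hx
  exact hz.1.1 i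

/-- The output of a profit-maximizing unit is a subgradient of its profit function. As `modX` need
not be closed, the maximizer is taken in its closure. -/
theorem exists_modProdProfit_subgradient (S : Market n m) (i : Fin n) (ε r : ℝ) :
    ∃ x ∈ S.X i, (∀ y ∈ S.modX i ε, S.prodProfitAt i r y ≤ S.prodProfitAt i r x) ∧
      ∀ q, S.modProdProfit i r ε + (q - r) * x.2 ≤ S.modProdProfit i q ε := by
  obtain ⟨x, hx, hmax⟩ := exists_mem_closure_sSup_image_eq (S.isCompact_X i) (modX_subset i ε)
    (S.continuousOn_prodProfitAt i r) ⟨_, S.off_mem_modX i ε⟩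
  refine ⟨x, closure_minimal (modX_subset i ε) (S.isCompact_X i).isClosed hx, fun y hy ↦ ?_,
    fun q ↦ ?_⟩
  · rw [← hmax]
    exact le_sSup_image_of_mem_closure (S.isCompact_X i) (modX_subset i ε)
      (S.continuousOn_prodProfitAt i r) (subset_closure hy)
  · have h := le_sSup_image_of_mem_closure (S.isCompact_X i) (modX_subset i ε)
      (S.continuousOn_prodProfitAt i q) hx
    rw [modProdProfit, modProdProfit, hmax]
    refine le_trans (le_of_eq ?_) h
    simp only [prodProfitAt]
    ring

/-! ### Consumers -/

/-- The profit, up to an additive constant, of a consumer with one step of price `b` who may take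
any quantity between `l` and `s`. -/
def stepProfit (b l s p : ℝ) : ℝ := max ((b - p) * l) ((b - p) * s)

/-- A quantity between `l` and `s` that maximizes the profit of a consumer with one step of
price `b`. At `p = b` all of them do, and the largest is chosen. -/
noncomputable def stepDemand (b l s p : ℝ) : ℝ := if p ≤ b then s else l

theorem stepProfit_sub_mul_le {b l s : ℝ} (h : l ≤ s) (r q : ℝ) :
    stepProfit b l s r - (q - r) * stepDemand b l s r ≤ stepProfit b l s q := by
  unfold stepProfit stepDemand
  split_ifs with hr
  · rw [max_eq_right (by nlinarith)]
    exact le_trans (le_of_eq (by ring)) (le_max_right _ _)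
  · rw [max_eq_left (by nlinarith)]
    exact le_trans (le_of_eq (by ring)) (le_max_left _ _)

theorem dmin_mem_Y (S : Market n m) (j : Fin m) : S.dmin j ∈ S.Y j :=
  left_mem_Icc.2 (S.dmin_le_dmax j)

theorem modY_subset (j : Fin m) (ρ : ℝ) : S.modY j ρ ⊆ S.Y j :=
  union_subset (fun _ hx ↦ hx.1) (iUnion₂_subset fun _ _ _ hx ↦ hx.1)

theorem dmin_mem_modY (S : Market n m) (j : Fin m) (ρ : ℝ) : S.dmin j ∈ S.modY j ρ :=
  Or.inl ⟨S.dmin_mem_Y j, rfl⟩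

theorem bddAbove_modY (j : Fin m) (ρ : ℝ) : BddAbove (S.modY j ρ) :=
  bddAbove_Icc.mono (modY_subset j ρ)

theorem dmin_le_sSup_modY (S : Market n m) (j : Fin m) (ρ : ℝ) : S.dmin j ≤ sSup (S.modY j ρ) :=
  le_csSup (bddAbove_modY j ρ) (S.dmin_mem_modY j ρ)

theorem sSup_modY_le_dmax (S : Market n m) (j : Fin m) (ρ : ℝ) : sSup (S.modY j ρ) ≤ S.dmax j :=
  csSup_le ⟨_, S.dmin_mem_modY j ρ⟩ fun _ hd ↦ (modY_subset j ρ hd).2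

theorem min_add_le_sSup_modY {j : Fin m} {ρ d : ℝ} (hρ : 0 ≤ ρ) (hd : d ∈ S.econCons j) :
    min (d + ρ) (S.dmax j) ≤ sSup (S.modY j ρ) := by
  have hY : d ∈ S.Y j := by
    obtain ⟨z, hz, rfl⟩ := hd
    exact hz.1.2.1 j
  have h1 : d ≤ min (d + ρ) (S.dmax j) := le_min (by linarith) hY.2
  refine le_csSup (bddAbove_modY j ρ)
    (Or.inr (mem_biUnion hd ⟨⟨hY.1.trans h1, min_le_right _ _⟩, ?_⟩))
  rw [abs_of_nonneg (by linarith)]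
  linarith [min_le_left (d + ρ) (S.dmax j)]

theorem lt_sSup_modY {j : Fin m} {ρ d : ℝ} (hρ : 0 < ρ) (hd : d ∈ S.econCons j)
    (hlt : sSup (S.modY j ρ) < S.dmax j) : d < sSup (S.modY j ρ) := by
  rcases min_le_iff.1 (min_add_le_sSup_modY hρ.le hd) with h | h <;> linarith

theorem sSup_consProfitAt_image {j : Fin m} {b β : ℝ} (hB : ∀ d ∈ S.Y j, S.B j d = β + b * d)
    (p : ℝ) {A : Set ℝ} (hA : A ⊆ S.Y j) (hmin : S.dmin j ∈ A) :
    sSup (S.consProfitAt j p '' A) = β + stepProfit b (S.dmin j) (sSup A) p := by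
  have hval : ∀ d ∈ A, S.consProfitAt j p d = β + (b - p) * d := fun d hd ↦ by
    rw [consProfitAt, hB d (hA hd)]; ring
  have hbdd : BddAbove A := bddAbove_Icc.mono hA
  have hle : ∀ d ∈ A, S.consProfitAt j p d ≤ β + stepProfit b (S.dmin j) (sSup A) p := by
    intro d hd
    rw [hval d hd, stepProfit]
    gcongr
    rcases le_total p b with h | h
    · exact le_max_of_le_right
        (mul_le_mul_of_nonneg_left (le_csSup hbdd hd) (by linarith))
    · exact le_max_of_le_left
        (mul_le_mul_of_nonpos_left (hA hd).1 (by linarith))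
  have hbi : BddAbove (S.consProfitAt j p '' A) :=
    ⟨_, by rintro _ ⟨d, hd, rfl⟩; exact hle d hd⟩
  refine le_antisymm (csSup_le (Nonempty.image _ ⟨_, hmin⟩) ?_) ?_
  · rintro _ ⟨d, hd, rfl⟩
    exact hle d hd
  · have hub : ∀ d ∈ A, β + (b - p) * d ≤ sSup (S.consProfitAt j p '' A) := fun d hd ↦ by
      rw [← hval d hd]
      exact le_csSup hbi (mem_image_of_mem _ hd)
    rw [stepProfit, ← le_sub_iff_add_le']
    refine max_le (by linarith [hub _ hmin]) ?_
    rcases le_or_gt b p with h | h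
    · refine le_trans (mul_le_mul_of_nonpos_left (le_csSup hbdd hmin) (by linarith)) ?_
      linarith [hub _ hmin]
    · have hpos : 0 < b - p := by linarith
      rw [← le_div_iff₀' hpos]
      refine csSup_le ⟨_, hmin⟩ fun d hd ↦ ?_
      rw [le_div_iff₀' hpos]
      linarith [hub d hd]

theorem modConsProfit_eq {j : Fin m} {b β : ℝ} (hB : ∀ d ∈ S.Y j, S.B j d = β + b * d)
    (p ρ : ℝ) :
    S.modConsProfit j p ρ = β + stepProfit b (S.dmin j) (sSup (S.modY j ρ)) p :=
  sSup_consProfitAt_image hB p (modY_subset j ρ) (S.dmin_mem_modY j ρ)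

theorem consProfit_eq {j : Fin m} {b β : ℝ} (hB : ∀ d ∈ S.Y j, S.B j d = β + b * d) (p : ℝ) :
    S.consProfit j p = β + stepProfit b (S.dmin j) (S.dmax j) p := by
  rw [consProfit, sSup_consProfitAt_image hB p subset_rfl (S.dmin_mem_Y j), Y,
    csSup_Icc (S.dmin_le_dmax j)]

/-! ### Economically feasible dispatches -/

/-- A dispatch supported by a price `r` is economically feasible: no unit gains at `r` from a
smaller status-output pair, and only consumers who value a unit of power at `r` or more exceed their
fixed load. -/
theorem econFeasible_of_supported {b β : Fin m → ℝ}
    (hB : ∀ j, ∀ d ∈ S.Y j, S.B j d = β j + b j * d) {r : ℝ}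
    {z : (Fin n → ℝ × ℝ) × (Fin m → ℝ)} (hz : z ∈ S.feasible)
    (hx : ∀ i, ∀ y ∈ S.X i, y ≤ z.1 i → S.prodProfitAt i r y ≤ S.prodProfitAt i r (z.1 i))
    (hd : ∀ j, r ≤ b j ∨ z.2 j = S.dmin j) : z ∈ S.econFeasible := by
  refine ⟨hz, fun z' hz' hle ↦ ?_⟩
  have h1 : ∑ i, S.prodProfitAt i r (z'.1 i) ≤ ∑ i, S.prodProfitAt i r (z.1 i) :=
    Finset.sum_le_sum fun i _ ↦ hx i _ (hz'.1 i) (hle.1 i)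
  have h2 : ∑ j, (S.B j (z'.2 j) - r * z'.2 j) ≤ ∑ j, (S.B j (z.2 j) - r * z.2 j) := by
    refine Finset.sum_le_sum fun j _ ↦ ?_
    rw [hB j _ (hz'.2.1 j), hB j _ (hz.2.1 j)]
    have hj : z'.2 j ≤ z.2 j := hle.2 j
    rcases hd j with h | h
    · nlinarith
    · rw [le_antisymm hj (h ▸ (hz'.2.1 j).1)]
  simp only [prodProfitAt, Finset.sum_sub_distrib, ← Finset.mul_sum] at h1 h2
  rw [hz.2.2] at h1
  rw [hz'.2.2] at h1
  simp only [welfare]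
  linarith

/-- A dispatch serving exactly the fixed loads is economically feasible if no unit is idling: the
power balance leaves nothing feasible below it. -/
theorem econFeasible_of_dmin {z : (Fin n → ℝ × ℝ) × (Fin m → ℝ)} (hz : z ∈ S.feasible)
    (hd : z.2 = S.dmin) (hx : ∀ i, (z.1 i).2 = 0 → (z.1 i).1 = 0) : z ∈ S.econFeasible := by
  refine ⟨hz, fun z' hz' hle ↦ ?_⟩
  have hd' : z'.2 = z.2 := le_antisymm hle.2 fun j ↦ by rw [hd]; exact (hz'.2.1 j).1
  have hg : ∀ i, (z'.1 i).2 = (z.1 i).2 := fun i ↦ by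
    refine (Finset.sum_eq_sum_iff_of_le fun i _ ↦ (hle.1 i).2).1 ?_ i (Finset.mem_univ i)
    rw [hz'.2.2, hd', hz.2.2]
  have hu : ∀ i, (z'.1 i).1 = (z.1 i).1 := fun i ↦ by
    have h1 : (z'.1 i).1 ≤ (z.1 i).1 := (hle.1 i).1
    rcases (hz.1 i).2.1.eq_or_lt with h | h
    · have h0 := hx i h.symm
      rcases (hz'.1 i).1 with h' | h' <;> linarith
    · rw [fst_eq_one_of_snd_pos (hz.1 i) h, fst_eq_one_of_snd_pos (hz'.1 i) (by rwa [hg i])]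
  have : z' = z := Prod.ext (funext fun i ↦ Prod.ext (hu i) (hg i)) hd'
  rw [this]

/-- Units whose outputs maximize profit at `r` over the economically feasible outputs do not gain
from any smaller output whatsoever, provided that together they supply at least the fixed loads, and
at most what the consumers may demand at `r`. -/
theorem prodProfitAt_le_of_le (hmin : S.ZeroMinOutput) {b β : Fin m → ℝ}
    (hB : ∀ j, ∀ d ∈ S.Y j, S.B j d = β j + b j * d) {r : ℝ} {x : Fin n → ℝ × ℝ}
    (hxX : ∀ i, x i ∈ S.X i) (hoff : ∀ i, 0 ≤ S.prodProfitAt i r (x i))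
    (hmax : ∀ i, ∀ y ∈ S.econProd i, S.prodProfitAt i r y ≤ S.prodProfitAt i r (x i))
    {d : Fin m → ℝ} (hdY : ∀ j, d j ∈ S.Y j) (hd : ∀ j, r ≤ b j ∨ d j = S.dmin j)
    (hsd : ∑ i, (x i).2 ≤ ∑ j, d j) (hds : ∑ j, S.dmin j ≤ ∑ i, (x i).2)
    (hstrict : (∃ z ∈ S.econFeasible, z.2 = S.dmin) → ∑ j, S.dmin j < ∑ i, (x i).2) :
    ∀ i, ∀ y ∈ S.X i, y ≤ x i → S.prodProfitAt i r y ≤ S.prodProfitAt i r (x i) := by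
  intro i₀ y₀ hy₀ hy₀x
  by_contra! hbad
  have hbest : ∀ i, ∃ y ∈ S.X i, y ≤ x i ∧
      ∀ y' ∈ S.X i, y' ≤ x i → S.prodProfitAt i r y' ≤ S.prodProfitAt i r y := fun i ↦ by
    obtain ⟨y, hy, hymax⟩ := ((S.isCompact_X i).inter_right isClosed_Iic).exists_isMaxOn
      ⟨x i, hxX i, le_refl (x i)⟩ ((S.continuousOn_prodProfitAt i r).mono inter_subset_left)
    exact ⟨y, hy.1, hy.2, fun y' h1 h2 ↦ hymax ⟨h1, h2⟩⟩
  choose y hyX hyx hymax using hbest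
  have hbad' : S.prodProfitAt i₀ r (x i₀) < S.prodProfitAt i₀ r (y i₀) :=
    hbad.trans_le (hymax i₀ y₀ hy₀ hy₀x)
  rcases le_or_gt (∑ j, S.dmin j) (∑ i, (y i).2) with hsum | hsum
  · -- The best smaller outputs cover the fixed loads and form an economically feasible dispatch.
    have hyd : ∑ i, (y i).2 ≤ ∑ j, d j :=
      (Finset.sum_le_sum fun i _ ↦ (hyx i).2).trans hsd
    obtain ⟨t, ht0, ht1, ht⟩ := exists_sum_add_mul_sub_eq hsum hyd
    have hz : (y, fun j ↦ S.dmin j + t * (d j - S.dmin j)) ∈ S.econFeasible := by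
      refine econFeasible_of_supported hB (r := r) ⟨hyX, fun j ↦ ?_, ht.symm⟩
        (fun i y' hy' hle ↦ hymax i y' hy' (hle.trans (hyx i))) fun j ↦ ?_
      · obtain ⟨h1, h2⟩ := hdY j
        exact ⟨by nlinarith, by nlinarith⟩
      · exact (hd j).imp_right fun h ↦ by simp [h]
    exact (hmax i₀ _ ⟨_, hz, rfl⟩).not_gt hbad'
  · -- Between `y` and `x` there are outputs `g` that cover exactly the fixed loads.
    obtain ⟨t, ht0, ht1, ht⟩ := exists_sum_add_mul_sub_eq hsum.le hds
    set g : Fin n → ℝ := fun i ↦ (y i).2 + t * ((x i).2 - (y i).2) with hg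
    have hyx2 : ∀ i, (y i).2 ≤ (x i).2 := fun i ↦ (hyx i).2
    have hg0 : ∀ i, 0 ≤ g i := fun i ↦
      add_nonneg (hyX i).2.1 (mul_nonneg ht0 (by linarith [hyx2 i]))
    have hgx : ∀ i, g i ≤ (x i).2 := fun i ↦ by
      have := hyx2 i
      simp only [hg]
      nlinarith
    set u : Fin n → ℝ := fun i ↦ if g i = 0 then 0 else 1 with hu
    have hz : (fun i ↦ (u i, g i), S.dmin) ∈ S.econFeasible := by
      refine econFeasible_of_dmin ⟨fun i ↦ ?_, S.dmin_mem_Y, ht⟩ rfl fun i h ↦ if_pos h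
      have := (hgx i).trans (snd_le_gmax (hxX i))
      by_cases h : g i = 0
      · simp [X, hu, h]
      · simp [X, hu, h, hmin i, hg0 i, this]
    have ht1' : t < 1 := by
      refine ht1.lt_of_ne fun h ↦ (hstrict ⟨_, hz, rfl⟩).ne ?_
      rw [← ht]
      simp [hg, h]
    have hle := hmax i₀ _ ⟨_, hz, rfl⟩
    -- Unit `i₀` is online in `y`, since staying offline is not better than `x i₀`.
    have hy1 : (y i₀).1 = 1 := by
      rcases (hyX i₀).1 with h | h
      · have h2 := (hyX i₀).2.2.2
        have h3 := (hyX i₀).2.1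
        rw [h, zero_mul] at h2
        have h4 : y i₀ = (0, 0) := Prod.ext h (le_antisymm h2 h3)
        have h5 : S.prodProfitAt i₀ r (0, 0) = 0 := by simp [prodProfitAt, cost_off]
        rw [h4, h5] at hbad'
        exact absurd (hoff i₀) hbad'.not_ge
      · exact h
    have hx1 : (x i₀).1 = 1 := by
      have : (y i₀).1 ≤ (x i₀).1 := (hyx i₀).1
      rcases (hxX i₀).1 with h | h <;> linarith
    have hgmem : (1 - t) * (y i₀).2 + t * (x i₀).2 ∈
        ({0} ∪ Icc (S.gmin i₀) (S.gmax i₀) : Set ℝ) := by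
      refine Or.inr ⟨?_, ?_⟩
      · rw [hmin i₀]
        linarith [hg0 i₀, show g i₀ = (y i₀).2 + t * ((x i₀).2 - (y i₀).2) from rfl]
      · linarith [(hgx i₀).trans (snd_le_gmax (hxX i₀)),
          show g i₀ = (y i₀).2 + t * ((x i₀).2 - (y i₀).2) from rfl]
    have hconv := S.c_convex i₀ _ (snd_mem_of_mem_X (hyX i₀)) _ (snd_mem_of_mem_X (hxX i₀))
      (1 - t) t (by linarith) ht0 (by ring) hgmem
    have hgi : g i₀ = (1 - t) * (y i₀).2 + t * (x i₀).2 := by simp only [hg]; ring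
    have hu1 : S.w i₀ * u i₀ ≤ S.w i₀ := by
      refine mul_le_of_le_one_right (S.w_nonneg i₀) ?_
      simp only [hu]
      split_ifs <;> norm_num
    simp only [prodProfitAt, cost, hx1, hy1] at hle hbad'
    rw [← hgi] at hconv
    have hmul := mul_lt_mul_of_pos_left hbad' (by linarith : 0 < 1 - t)
    have hrg : r * g i₀ = (1 - t) * (r * (y i₀).2) + t * (r * (x i₀).2) := by rw [hgi]; ring
    linarith

/-! ### Invariance of the set of market prices -/

/-- If the supply of the profit-maximizing units at price `r` lies between the demand of the
modified and of the original consumers, then these demands agree. -/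
theorem demand_eq_of_supply_between (hmin : S.ZeroMinOutput) {b β : Fin m → ℝ}
    (hB : ∀ j, ∀ d ∈ S.Y j, S.B j d = β j + b j * d) {ε : Fin n → ℝ} {ρ : Fin m → ℝ}
    (hε : ∀ i, 0 < ε i) (hρ : ∀ j, 0 < ρ j) {r : ℝ} {x : Fin n → ℝ × ℝ}
    (hxX : ∀ i, x i ∈ S.X i)
    (hmax : ∀ i, ∀ y ∈ S.modX i (ε i), S.prodProfitAt i r y ≤ S.prodProfitAt i r (x i))
    (h1 : ∑ j, stepDemand (b j) (S.dmin j) (sSup (S.modY j (ρ j))) r ≤ ∑ i, (x i).2)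
    (h2 : ∑ i, (x i).2 ≤ ∑ j, stepDemand (b j) (S.dmin j) (S.dmax j) r) :
    ∑ j, stepDemand (b j) (S.dmin j) (sSup (S.modY j (ρ j))) r =
      ∑ j, stepDemand (b j) (S.dmin j) (S.dmax j) r := by
  set d' : Fin m → ℝ := fun j ↦ stepDemand (b j) (S.dmin j) (sSup (S.modY j (ρ j))) r with hd'
  set d : Fin m → ℝ := fun j ↦ stepDemand (b j) (S.dmin j) (S.dmax j) r with hd
  have hmind' : ∀ j, S.dmin j ≤ d' j := fun j ↦ by
    simp only [hd', stepDemand]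
    split_ifs
    exacts [S.dmin_le_sSup_modY j _, le_rfl]
  have hd'd : ∀ j, d' j ≤ d j := fun j ↦ by
    simp only [hd', hd, stepDemand]
    split_ifs
    exacts [S.sSup_modY_le_dmax j _, le_rfl]
  have hdmax : ∀ j, d j ≤ S.dmax j := fun j ↦ by
    simp only [hd, stepDemand]
    split_ifs
    exacts [le_rfl, S.dmin_le_dmax j]
  have hdr : ∀ j, r ≤ b j ∨ d j = S.dmin j := fun j ↦ by
    simp only [hd, stepDemand]
    split_ifs with h
    exacts [Or.inl h, Or.inr rfl]
  by_contra hne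
  obtain ⟨k, hk⟩ : ∃ k, d' k < d k := by
    by_contra! h
    exact hne (Finset.sum_congr rfl fun j _ ↦ le_antisymm (hd'd j) (h j))
  have hrk : r ≤ b k := by
    by_contra! h
    simp [hd', hd, stepDemand, not_le.2 h] at hk
  have hd'k : d' k = sSup (S.modY k (ρ k)) := if_pos hrk
  have hcurt : ∀ e ∈ S.econCons k, e < d' k := fun e he ↦ by
    rw [hd'k]
    exact lt_sSup_modY (hρ k) he (by rw [← hd'k]; exact hk.trans_le (hdmax k))
  have hsupp := prodProfitAt_le_of_le hmin hB (r := r) hxX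
    (fun i ↦ by
      have := hmax i _ (S.off_mem_modX i (ε i))
      simpa [prodProfitAt, cost_off] using this)
    (fun i y hy ↦ hmax i y (econProd_subset_modX (hε i).le hy))
    (d := d) (fun j ↦ ⟨(hmind' j).trans (hd'd j), hdmax j⟩) hdr h2
    ((Finset.sum_le_sum fun j _ ↦ hmind' j).trans h1)
    (by
      rintro ⟨z, hz, hzd⟩
      refine (Finset.sum_lt_sum (fun j _ ↦ hmind' j) ⟨k, Finset.mem_univ k, ?_⟩).trans_le h1
      exact hcurt _ ⟨z, hz, by rw [hzd]⟩)
  obtain ⟨t, ht0, ht1, ht⟩ := exists_sum_add_mul_sub_eq h1 h2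
  have hge : ∀ j, d' j ≤ d' j + t * (d j - d' j) := fun j ↦ by nlinarith [hd'd j]
  have hz : (x, fun j ↦ d' j + t * (d j - d' j)) ∈ S.econFeasible := by
    refine econFeasible_of_supported hB (r := r) ⟨hxX, fun j ↦ ⟨(hmind' j).trans (hge j), ?_⟩,
      ht.symm⟩ hsupp fun j ↦ (hdr j).imp_right fun h ↦ ?_
    · have := hdmax j
      have := hd'd j
      nlinarith
    · have : d' j = S.dmin j := le_antisymm ((hd'd j).trans h.le) (hmind' j)
      simp [h, this]
  exact (hcurt _ ⟨_, hz, rfl⟩).not_ge (hge k)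

theorem replacedPrices_eq_modPrices (hmin : S.ZeroMinOutput) (hstep : S.OneStepBids)
    {ε : Fin n → ℝ} {ρ : Fin m → ℝ} (hε : ∀ i, 0 < ε i) (hρ : ∀ j, 0 < ρ j) :
    S.replacedPrices ε = S.modPrices ε ρ := by
  obtain ⟨b, β, hb⟩ := hstep
  have hB := fun j ↦ (hb j).2
  choose x hxX hxmax hxsub using fun r i ↦ S.exists_modProdProfit_subgradient i (ε i) r
  have hsub : ∀ (s : Fin m → ℝ), (∀ j, S.dmin j ≤ s j) → ∀ r q,
      (∑ j, (β j + stepProfit (b j) (S.dmin j) (s j) r) + ∑ i, S.modProdProfit i r (ε i)) +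
        (q - r) * (∑ i, (x r i).2 - ∑ j, stepDemand (b j) (S.dmin j) (s j) r) ≤
      ∑ j, (β j + stepProfit (b j) (S.dmin j) (s j) q) + ∑ i, S.modProdProfit i q (ε i) := by
    intro s hs r q
    have h1 : ∑ i, (S.modProdProfit i r (ε i) + (q - r) * (x r i).2) ≤
        ∑ i, S.modProdProfit i q (ε i) := Finset.sum_le_sum fun i _ ↦ hxsub r i q
    have h2 : ∑ j, ((β j + stepProfit (b j) (S.dmin j) (s j) r) -
        (q - r) * stepDemand (b j) (S.dmin j) (s j) r) ≤
        ∑ j, (β j + stepProfit (b j) (S.dmin j) (s j) q) :=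
      Finset.sum_le_sum fun j _ ↦ by linarith [stepProfit_sub_mul_le (b := b j) (hs j) r q]
    rw [Finset.sum_add_distrib, ← Finset.mul_sum] at h1
    rw [Finset.sum_sub_distrib, ← Finset.mul_sum] at h2
    linarith
  simp only [replacedPrices, modPrices, fun j p ↦ consProfit_eq (hB j) p,
    fun j p ↦ modConsProfit_eq (hB j) p (ρ j)]
  refine setOf_minimizers_eq (hsub _ fun j ↦ S.dmin_le_sSup_modY j (ρ j))
    (hsub _ S.dmin_le_dmax) (fun r ↦ Finset.sum_le_sum fun j _ ↦ ?_)
    fun r ↦ demand_eq_of_supply_between hmin hB hε hρ (hxX r) (hxmax r)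
  unfold stepDemand
  split_ifs
  exacts [S.sSup_modY_le_dmax j _, le_rfl]

/-! ### A market in which the uplifts change -/

/-- Two units of capacity `1` with start-up cost `1` and no variable cost, and a consumer who values
up to `3/2` units of power at `6/5` each. -/
noncomputable def twoUnitMarket : Market 2 1 where
  gmin _ := 0
  gmax _ := 1
  w _ := 1
  c _ _ := 0
  dmin _ := 0
  dmax _ := 3 / 2
  B _ d := 6 / 5 * d
  gmin_nonneg _ := le_rfl
  gmin_le_gmax _ := zero_le_one
  w_nonneg _ := zero_le_one
  c_zero _ := rfl
  c_mono _ := monotoneOn_const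
  c_cont _ := continuousOn_const
  c_convex _ _ _ _ _ _ _ _ _ _ _ := by simp
  dmin_nonneg _ := le_rfl
  dmin_le_dmax _ := by norm_num
  B_cont _ := by fun_prop
  B_concave _ := (LinearMap.concaveOn (LinearMap.mul ℝ ℝ (6 / 5)) (convex_Icc _ _))

namespace twoUnitMarket

theorem mem_X {i : Fin 2} {x : ℝ × ℝ} :
    x ∈ twoUnitMarket.X i ↔ (x.1 = 0 ∨ x.1 = 1) ∧ 0 ≤ x.2 ∧ x.2 ≤ x.1 := by
  simp only [X, twoUnitMarket, mem_ofPred_eq, mul_zero, mul_one]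
  tauto

theorem mem_feasible {z : (Fin 2 → ℝ × ℝ) × (Fin 1 → ℝ)} :
    z ∈ twoUnitMarket.feasible ↔ (z.1 0 ∈ twoUnitMarket.X 0 ∧ z.1 1 ∈ twoUnitMarket.X 1) ∧
      (0 ≤ z.2 0 ∧ z.2 0 ≤ 3 / 2) ∧ (z.1 0).2 + (z.1 1).2 = z.2 0 := by
  simp [feasible, Fin.forall_fin_two, Fin.sum_univ_two, Y, twoUnitMarket]

theorem welfare_eq (z : (Fin 2 → ℝ × ℝ) × (Fin 1 → ℝ)) :
    twoUnitMarket.welfare z = 6 / 5 * z.2 0 - ((z.1 0).1 + (z.1 1).1) := by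
  simp [welfare, cost, Fin.sum_univ_two, twoUnitMarket]

theorem oneStep (j : Fin 1) :
    ∀ d ∈ twoUnitMarket.Y j, twoUnitMarket.B j d = 0 + 6 / 5 * d := by
  simp [twoUnitMarket]

/-- The dispatch in which unit `i` alone produces, at full capacity. -/
noncomputable def singleUnit (i : Fin 2) : (Fin 2 → ℝ × ℝ) × (Fin 1 → ℝ) :=
  (fun k ↦ if k = i then (1, 1) else (0, 0), fun _ ↦ 1)

theorem singleUnit_mem_optimal (i : Fin 2) : singleUnit i ∈ twoUnitMarket.optimal := by
  have hw : twoUnitMarket.welfare (singleUnit i) = 1 / 5 := by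
    rw [welfare_eq]
    fin_cases i <;> norm_num [singleUnit]
  refine ⟨?_, fun z hz ↦ ?_⟩
  · rw [mem_feasible]
    fin_cases i <;> norm_num [singleUnit, mem_X]
  · rw [hw, welfare_eq]
    obtain ⟨⟨h0, h1⟩, ⟨-, hd⟩, hs⟩ := mem_feasible.1 hz
    obtain ⟨hu0, -, hg0⟩ := mem_X.1 h0
    obtain ⟨hu1, -, hg1⟩ := mem_X.1 h1
    rcases hu0 with hu0 | hu0 <;> rcases hu1 with hu1 | hu1 <;> linarith

theorem singleUnit_mem_econFeasible (i : Fin 2) : singleUnit i ∈ twoUnitMarket.econFeasible :=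
  ⟨(singleUnit_mem_optimal i).1, fun z hz _ ↦ (singleUnit_mem_optimal i).2 z hz⟩

theorem le_one_of_mem_econFeasible {z : (Fin 2 → ℝ × ℝ) × (Fin 1 → ℝ)}
    (hz : z ∈ twoUnitMarket.econFeasible) : z.2 0 ≤ 1 := by
  by_contra! hgt
  obtain ⟨⟨h0, h1⟩, ⟨-, hd⟩, hs⟩ := mem_feasible.1 hz.1
  have h0' := mem_X.1 h0
  have h1' := mem_X.1 h1
  have hu0 : (z.1 0).1 = 1 := h0'.1.resolve_left fun h ↦ by
    rcases h1'.1 with h' | h' <;> linarith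
  have hu1 : (z.1 1).1 = 1 := h1'.1.resolve_left fun h ↦ by
    rcases h0'.1 with h' | h' <;> linarith
  -- Switching off the unit with the smaller output, at most `3/4`, saves more than it costs.
  rcases le_total (z.1 0).2 (z.1 1).2 with h | h
  · have := hz.2 (![(0, 0), z.1 1], fun _ ↦ (z.1 1).2)
      (mem_feasible.2 ⟨⟨mem_X.2 (by simp), h1⟩, ⟨h1'.2.1, by
        change (z.1 1).2 ≤ 3 / 2; linarith⟩, by simp⟩)
      ⟨Fin.forall_fin_two.2 ⟨⟨by simp [hu0], h0'.2.1⟩, le_refl (z.1 1)⟩,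
        Fin.forall_fin_one.2 (by change (z.1 1).2 ≤ z.2 0; linarith)⟩
    simp [welfare_eq] at this
    linarith
  · have := hz.2 (![z.1 0, (0, 0)], fun _ ↦ (z.1 0).2)
      (mem_feasible.2 ⟨⟨h0, mem_X.2 (by simp)⟩, ⟨h0'.2.1, by
        change (z.1 0).2 ≤ 3 / 2; linarith⟩, by simp⟩)
      ⟨Fin.forall_fin_two.2 ⟨le_refl (z.1 0), ⟨by simp [hu1], h1'.2.1⟩⟩,
        Fin.forall_fin_one.2 (by change (z.1 0).2 ≤ z.2 0; linarith)⟩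
    simp [welfare_eq] at this
    linarith

theorem modProdProfit_eq (i : Fin 2) {ε : ℝ} (hε : 0 ≤ ε) (p : ℝ) :
    twoUnitMarket.modProdProfit i p ε = max 0 (p - 1) := by
  have hval : ∀ x : ℝ × ℝ, twoUnitMarket.prodProfitAt i p x = p * x.2 - x.1 := fun x ↦ by
    simp [prodProfitAt, cost, twoUnitMarket]
  have hon : ((1, 1) : ℝ × ℝ) ∈ twoUnitMarket.modX i ε :=
    econProd_subset_modX hε ⟨_, singleUnit_mem_econFeasible i, if_pos rfl⟩
  refine IsLUB.csSup_eq ⟨?_, fun M hM ↦ max_le ?_ ?_⟩ (Nonempty.image _ ⟨_, hon⟩)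
  · rintro _ ⟨x, hx, rfl⟩
    rw [hval]
    obtain ⟨hu, hg0, hg1⟩ := mem_X.1 (modX_subset i ε hx)
    rcases hu with hu | hu <;> rw [hu] at hg1 ⊢
    · rw [le_antisymm hg1 hg0]
      simp
    · rcases le_total 0 p with hp | hp
      · exact le_max_of_le_right (by nlinarith)
      · exact le_max_of_le_left (by nlinarith)
  · have := hM (mem_image_of_mem _ (twoUnitMarket.off_mem_modX i ε))
    simpa [hval] using this
  · have := hM (mem_image_of_mem _ hon)
    simpa [hval] using this

theorem one_le_sSup_modY {ρ : ℝ} (hρ : 0 ≤ ρ) : 1 ≤ sSup (twoUnitMarket.modY 0 ρ) := by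
  have h : (1 : ℝ) ∈ twoUnitMarket.econCons 0 := ⟨_, singleUnit_mem_econFeasible 0, rfl⟩
  refine le_trans (le_min (by linarith) ?_) (min_add_le_sSup_modY hρ h)
  norm_num [twoUnitMarket]

theorem sSup_modY_le {ρ : ℝ} (hρ : 0 ≤ ρ) : sSup (twoUnitMarket.modY 0 ρ) ≤ 1 + ρ := by
  refine csSup_le ⟨_, twoUnitMarket.dmin_mem_modY 0 ρ⟩ fun d hd ↦ ?_
  rcases hd with hd | hd
  · have h : 6 / 5 * d = 6 / 5 * (0 : ℝ) := hd.2
    linarith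
  · obtain ⟨e, ⟨z, hz, rfl⟩, -, he⟩ := mem_iUnion₂.1 hd
    linarith [(abs_le.1 he).2, le_one_of_mem_econFeasible hz]

theorem modConsProfit_eq_max {ρ : ℝ} (p : ℝ) : twoUnitMarket.modConsProfit 0 p ρ =
    max 0 ((6 / 5 - p) * sSup (twoUnitMarket.modY 0 ρ)) := by
  rw [modConsProfit_eq (oneStep 0), stepProfit]
  simp [twoUnitMarket]

theorem modPrices_eq {ε : Fin 2 → ℝ} {ρ : Fin 1 → ℝ} (hε : ∀ i, 0 < ε i) (hρ : 0 < ρ 0)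
    (hρ' : ρ 0 < 1) : twoUnitMarket.modPrices ε ρ = {1} := by
  set D := sSup (twoUnitMarket.modY 0 (ρ 0)) with hD
  have hD1 : 1 ≤ D := one_le_sSup_modY hρ.le
  have hD2 : D < 2 := (sSup_modY_le hρ.le).trans_lt (by linarith)
  set f : ℝ → ℝ := fun p ↦ max 0 ((6 / 5 - p) * D) + 2 * max 0 (p - 1) with hf
  have hfe : ∀ p, ∑ j, twoUnitMarket.modConsProfit j p (ρ j) +
      ∑ i, twoUnitMarket.modProdProfit i p (ε i) = f p := fun p ↦ by
    rw [Fin.sum_univ_one, Fin.sum_univ_two, modProdProfit_eq 0 (hε 0).le,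
      modProdProfit_eq 1 (hε 1).le, modConsProfit_eq_max, ← two_mul]
  have hf1 : f 1 = D / 5 := by
    simp only [hf]
    rw [max_eq_right (by linarith)]
    norm_num
    ring
  have hlt : ∀ p, p ≠ 1 → D / 5 < f p := by
    intro p hp
    have a1 : (6 / 5 - p) * D ≤ max 0 ((6 / 5 - p) * D) := le_max_right _ _
    have a2 : 0 ≤ max 0 ((6 / 5 - p) * D) := le_max_left _ _
    have a3 : p - 1 ≤ max 0 (p - 1) := le_max_right _ _
    have a4 : 0 ≤ max 0 (p - 1) := le_max_left _ _
    simp only [hf]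
    rcases lt_or_gt_of_ne hp with h | h
    · nlinarith
    · nlinarith
  ext p
  simp only [modPrices, hfe, mem_ofPred_eq, mem_singleton_iff]
  constructor
  · intro h
    by_contra hp
    linarith [h 1, hlt p hp]
  · rintro rfl q
    rcases eq_or_ne q 1 with rfl | hq
    · exact le_rfl
    · linarith [hlt q hq]

end twoUnitMarket

end Market

theorem proposition7 :
    -- the set of market prices does not change
    (∀ (n m : ℕ) (S : Market n m), S.feasible.Nonempty → S.ZeroMinOutput → S.OneStepBids →
      ∀ (ε : Fin n → ℝ) (ρ : Fin m → ℝ), (∀ i, 0 < ε i) → (∀ j, 0 < ρ j) →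
        S.replacedPrices ε = S.modPrices ε ρ) ∧
    -- the uplifts can change, by an amount that persists as `ε, ρ → 0`
    (∃ (n m : ℕ) (S : Market n m), S.optimal.Nonempty ∧ S.ZeroMinOutput ∧ S.OneStepBids ∧
      ∃ η > 0, ∃ δ > 0, ∀ (ε : Fin n → ℝ) (ρ : Fin m → ℝ),
        (∀ i, 0 < ε i ∧ ε i < δ) → (∀ j, 0 < ρ j ∧ ρ j < δ) →
          (S.modPrices ε ρ).Nonempty ∧
          ∀ p ∈ S.modPrices ε ρ, ∀ z ∈ S.optimal,
            S.totalUplift p ε ρ z + η ≤ S.replacedTotalUplift p ε z ∧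
            ∃ j, S.consUplift j p (ρ j) z + η ≤ S.replacedConsUplift j p z) := by
  refine ⟨fun n m S _ hmin hstep ε ρ hε hρ ↦ Market.replacedPrices_eq_modPrices hmin hstep hε hρ,
    2, 1, Market.twoUnitMarket, ⟨_, Market.twoUnitMarket.singleUnit_mem_optimal 0⟩, fun _ ↦ rfl,
    ⟨fun _ ↦ 6 / 5, fun _ ↦ 0, fun j ↦ ⟨by norm_num, Market.twoUnitMarket.oneStep j⟩⟩,
    1 / 20, by norm_num, 1 / 4, by norm_num, fun ε ρ hε hρ ↦ ?_⟩
  rw [Market.twoUnitMarket.modPrices_eq (fun i ↦ (hε i).1) (hρ 0).1 (by linarith [(hρ 0).2])]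
  refine ⟨singleton_nonempty 1, ?_⟩
  rintro p rfl z -
  have hD := Market.twoUnitMarket.sSup_modY_le (hρ 0).1.le
  have hgap : Market.twoUnitMarket.modConsProfit 0 1 (ρ 0) + 1 / 20 ≤
      Market.twoUnitMarket.consProfit 0 1 := by
    rw [Market.twoUnitMarket.modConsProfit_eq_max,
      Market.consProfit_eq (Market.twoUnitMarket.oneStep 0), Market.stepProfit]
    have h1 : max 0 ((6 / 5 - 1) * sSup (Market.twoUnitMarket.modY 0 (ρ 0))) ≤ 1 / 4 :=
      max_le (by norm_num) (by linarith [(hρ 0).2])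
    have h2 : (6 / 5 - 1) * Market.twoUnitMarket.dmax 0 = 3 / 10 := by
      norm_num [Market.twoUnitMarket]
    have h3 := le_max_right ((6 / 5 - 1) * Market.twoUnitMarket.dmin 0)
      ((6 / 5 - 1) * Market.twoUnitMarket.dmax 0)
    linarith
  constructor
  · simp only [Market.totalUplift, Market.replacedTotalUplift, Fin.sum_univ_one,
      Market.consUplift, Market.replacedConsUplift]
    linarith
  · refine ⟨0, ?_⟩
    simp only [Market.consUplift, Market.replacedConsUplift]
    linarith
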